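/- Let $(M,\omega)$ be a connected $2n$-dimensional symplectic manifold, with Hamiltonian vector fields defined by $df(\xi)=\omega(\xi,X_f)$ and Poisson bracket $\{f_1,f_2\}=\omega(X_{f_2},X_{f_1})=df_1(X_{f_2})$. Let a connected Lie group $G$ with Lie algebra $\mathfrak g$ act smoothly, freely and properly on $M$, and let the action be Hamiltonian: $G$ acts by symplectomorphisms and there is a momentum mapping $\Phi:M\to\mathfrak g^*$ such that, with $\phi_\xi(x)=(\Phi(x),\xi)$, the infinitesimal generator of the action of $\xi\in\mathfrak g$ is $X_{\phi_\xi}$, and $\phi_{[\xi,\eta]}=\{\phi_\xi,\phi_\eta\}$ for all $\xi,\eta\in\mathfrak g$. Let $\pi:M\to M/G$ be the projection onto the quotient manifold (with the smooth structure for which $\pi$ is a submersion), endowed with the reduced Poisson bracket given by $\{F_1,F_2\}^G\circ\pi=\{F_1\circ\pi,F_2\circ\pi\}$. Let $h\in C^\infty(M)$ be $G$-invariant and let $H$ be the function on $M/G$ with $h=H\circ\pi$. For a linear space $\mathcal F$ of smooth functions on a Poisson manifold $(N,\{\cdot,\cdot\})$ that is closed under the bracket, let $F_x=\mathrm{span}\{df(x)\mid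 f\in\mathcal F\}\subset T_x^*N$ and let $K_x=\ker\{\cdot,\cdot\}|_{F_x}$. Write $\mathrm{ddim}\,\mathcal F=l$ and $\mathrm{dind}\,\mathcal F=r$ if $\dim F_x=l$ and $\dim K_x=r$ on an open dense subset of $N$, and let $\mathrm{corank}\{\cdot,\cdot\}$ be the dimension of the kernel of the Poisson structure on $T_x^*N$ for $x$ in an open dense subset of $N$ (it is $0$ if $N$ is symplectic). The algebra $\mathcal F$ is complete if $\mathrm{ddim}\,\mathcal F+\mathrm{dind}\,\mathcal F=\dim N+\mathrm{corank}\{\cdot,\cdot\}$. A Hamiltonian system $\dot f=\{f,h\}$ on $N$ is completely integrable (in the noncommutative sense) if there is a complete algebra $\mathcal F$ all of whose elements $f$ are first integrals, i.e. $\{f,h\}=0$. Theorem. If the reduced flow $\dot F=\{F,H\}^G$ on $M/G$ is completely integrable in the noncommutative sense, then the original system $\dot x=X_h(x)$ on $M$ is completely integrable in the noncommutative sense. -/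

import Mathlib

open scoped Manifold ContDiff Topology

noncomputable section

namespace PoissonReduction

/-! ### Functions on manifolds: differentials, smoothness -/

section Brackets

variable {E : Type*} [NormedAddCommGroup E] [NormedSpace ℝ E]
  {N : Type*} [TopologicalSpace N] [ChartedSpace E N]

/-- The differential `df(x)` of a real function, as an element of the cotangent space at `x`. -/
def differential (E : Type*) [NormedAddCommGroup E] [NormedSpace ℝ E]
    {N : Type*} [TopologicalSpace N] [ChartedSpace E N] (f : N → ℝ) (x : N) :
    TangentSpace 𝓘(ℝ, E) x →L[ℝ] ℝ :=
  mfderiv 𝓘(ℝ, E) 𝓘(ℝ, ℝ) f x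

/-- The set `C^∞(N)` of smooth real functions. -/
def smoothFunctions (E : Type*) [NormedAddCommGroup E] [NormedSpace ℝ E]
    (N : Type*) [TopologicalSpace N] [ChartedSpace E N] : Set (N → ℝ) :=
  {f | ContMDiff 𝓘(ℝ, E) 𝓘(ℝ, ℝ) ∞ f}

/-- `F_x = span {df(x) : f ∈ F}`. -/
def diffSpan (E : Type*) [NormedAddCommGroup E] [NormedSpace ℝ E]
    {N : Type*} [TopologicalSpace N] [ChartedSpace E N] (F : Set (N → ℝ)) (x : N) :
    Submodule ℝ (TangentSpace 𝓘(ℝ, E) x →L[ℝ] ℝ) :=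
  Submodule.span ℝ ((fun f => differential E f x) '' F)

/-- `K_x`, the kernel of the Poisson structure `br` restricted to `F_x`: the differentials at `x`
of those `f ∈ F` with `{f, g}(x) = 0` for all `g ∈ F`. (For a linear space `F` of smooth functions
and a Poisson bracket these differentials form a linear space, and `F_x = {df(x) : f ∈ F}`.) -/
def diffKernel (E : Type*) [NormedAddCommGroup E] [NormedSpace ℝ E]
    {N : Type*} [TopologicalSpace N] [ChartedSpace E N]
    (br : (N → ℝ) → (N → ℝ) → N → ℝ) (F : Set (N → ℝ)) (x : N) :
    Submodule ℝ (TangentSpace 𝓘(ℝ, E) x →L[ℝ] ℝ) :=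
  Submodule.span ℝ ((fun f => differential E f x) '' {f | f ∈ F ∧ ∀ g ∈ F, br f g x = 0})

/-- `ddim F = l` and `dind F = r`: on an open dense set, `dim F_x = l` and `dim K_x = r`. -/
def HasDdimDind (E : Type*) [NormedAddCommGroup E] [NormedSpace ℝ E]
    {N : Type*} [TopologicalSpace N] [ChartedSpace E N]
    (br : (N → ℝ) → (N → ℝ) → N → ℝ) (F : Set (N → ℝ)) (l r : ℕ) : Prop :=
  ∃ U : Set N, IsOpen U ∧ Dense U ∧ ∀ x ∈ U,
    Module.finrank ℝ (diffSpan E F x) = l ∧ Module.finrank ℝ (diffKernel E br F x) = r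

/-- The Poisson structure `br` has corank `c`: on an open dense set, the kernel of the
Poisson structure on the whole cotangent space `T_x^* N` has dimension `c`. -/
def HasCorank (E : Type*) [NormedAddCommGroup E] [NormedSpace ℝ E]
    {N : Type*} [TopologicalSpace N] [ChartedSpace E N]
    (br : (N → ℝ) → (N → ℝ) → N → ℝ) (c : ℕ) : Prop :=
  ∃ U : Set N, IsOpen U ∧ Dense U ∧ ∀ x ∈ U,
    Module.finrank ℝ (diffKernel E br (smoothFunctions E N) x) = c

/-- `F` is an algebra (with respect to the Poisson bracket `br`) of first integrals of
`ḟ = {f, h}`: a linear space of smooth functions, closed under the Poisson bracket, all of whose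
elements commute with `h`. -/
structure IsAlgebraOfIntegrals (E : Type*) [NormedAddCommGroup E] [NormedSpace ℝ E]
    {N : Type*} [TopologicalSpace N] [ChartedSpace E N]
    (br : (N → ℝ) → (N → ℝ) → N → ℝ) (h : N → ℝ) (F : Submodule ℝ (N → ℝ)) : Prop where
  smooth : ∀ f ∈ F, ContMDiff 𝓘(ℝ, E) 𝓘(ℝ, ℝ) ∞ f
  bracket_mem : ∀ f ∈ F, ∀ g ∈ F, br f g ∈ F
  integral : ∀ f ∈ F, ∀ x, br f h x = 0

/-- Complete integrability in the noncommutative sense of the Hamiltonian system `ḟ = {f, h}` on a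
Poisson manifold: there is an algebra `F` of first integrals which is complete, that is,
`ddim F + dind F = dim N + corank {·,·}`. -/
def PoissonCompletelyIntegrable (E : Type*) [NormedAddCommGroup E] [NormedSpace ℝ E]
    {N : Type*} [TopologicalSpace N] [ChartedSpace E N]
    (br : (N → ℝ) → (N → ℝ) → N → ℝ) (h : N → ℝ) : Prop :=
  ∃ F : Submodule ℝ (N → ℝ), IsAlgebraOfIntegrals E br h F ∧
    ∃ l r c : ℕ, HasDdimDind E br (F : Set (N → ℝ)) l r ∧ HasCorank E br c ∧
      l + r = Module.finrank ℝ E + c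

end Brackets

/-! ### Symplectic manifolds -/

/-- A symplectic form on a manifold `M` modelled on `E`: a smooth, closed, nondegenerate
2-form. -/
structure SymplecticForm (E : Type*) [NormedAddCommGroup E] [NormedSpace ℝ E]
    (M : Type*) [TopologicalSpace M] [ChartedSpace E M] [IsManifold 𝓘(ℝ, E) ∞ M] where
  /-- The bilinear form on each tangent space. -/
  form (x : M) : TangentSpace 𝓘(ℝ, E) x →L[ℝ] TangentSpace 𝓘(ℝ, E) x →L[ℝ] ℝ
  alternating : ∀ x v, form x v v = 0
  nondegenerate : ∀ x v, (∀ w, form x v w = 0) → v = 0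
  smooth : ContMDiff 𝓘(ℝ, E) (𝓘(ℝ, E).prod 𝓘(ℝ, E →L[ℝ] E →L[ℝ] ℝ)) ∞
    (fun x => Bundle.TotalSpace.mk' (E →L[ℝ] E →L[ℝ] ℝ) x (form x))
  /-- `dΩ = 0`: in every chart `φ` of the manifold the coefficients
  `Ω_{uv}(y) = (φ⁻¹)^*Ω (y)(u, v)` satisfy `∂_u Ω_{vw} + ∂_v Ω_{wu} + ∂_w Ω_{uv} = 0`. -/
  closed : ∀ (x₀ : M), ∀ y ∈ (chartAt E x₀).target, ∀ u v w : E,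
    let A : (z : E) → E →L[ℝ] TangentSpace 𝓘(ℝ, E) ((chartAt E x₀).symm z) :=
      fun z => mfderiv 𝓘(ℝ, E) 𝓘(ℝ, E) (chartAt E x₀).symm z
    let c : E → E → E → ℝ := fun a b z => form ((chartAt E x₀).symm z) (A z a) (A z b)
    fderiv ℝ (c v w) y u + fderiv ℝ (c w u) y v + fderiv ℝ (c u v) y w = 0

section Symplectic

variable {E : Type*} [NormedAddCommGroup E] [NormedSpace ℝ E] [FiniteDimensional ℝ E]
  {M : Type*} [TopologicalSpace M] [ChartedSpace E M] [IsManifold 𝓘(ℝ, E) ∞ M]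

theorem SymplecticForm.antisymm (Ω : SymplecticForm E M) (x : M) (u v : TangentSpace 𝓘(ℝ, E) x) :
    Ω.form x u v = - Ω.form x v u := by
  have h := Ω.alternating x (u + v)
  simp only [map_add, ContinuousLinearMap.add_apply, Ω.alternating] at h
  linarith

theorem SymplecticForm.exists_hamiltonian (Ω : SymplecticForm E M) (f : M → ℝ) (x : M) :
    ∃ X : TangentSpace 𝓘(ℝ, E) x, ∀ v, Ω.form x v X = differential E f x v := by
  haveI : FiniteDimensional ℝ (TangentSpace 𝓘(ℝ, E) x) :=
    inferInstanceAs (FiniteDimensional ℝ E)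
  let L : TangentSpace 𝓘(ℝ, E) x →ₗ[ℝ] Module.Dual ℝ (TangentSpace 𝓘(ℝ, E) x) :=
    { toFun := fun X => -((Ω.form x X : TangentSpace 𝓘(ℝ, E) x →L[ℝ] ℝ) :
        TangentSpace 𝓘(ℝ, E) x →ₗ[ℝ] ℝ)
      map_add' := fun a b => by ext v; simp; ring
      map_smul' := fun a b => by ext v; simp }
  have hL : Function.Injective L := by
    rw [← LinearMap.ker_eq_bot, LinearMap.ker_eq_bot']
    intro X hX
    refine Ω.nondegenerate x X fun w => ?_
    have := LinearMap.congr_fun hX w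
    simpa [L] using this
  have hs : Function.Surjective L :=
    (LinearMap.injective_iff_surjective_of_finrank_eq_finrank
      (Subspace.dual_finrank_eq).symm).1 hL
  obtain ⟨X, hX⟩ := hs (differential E f x : TangentSpace 𝓘(ℝ, E) x →ₗ[ℝ] ℝ)
  refine ⟨X, fun v => ?_⟩
  have := LinearMap.congr_fun hX v
  rw [Ω.antisymm]
  simpa [L] using this

/-- The Hamiltonian vector field `X_f`, determined by `df(v) = Ω(v, X_f)`. -/
def SymplecticForm.hamiltonianField (Ω : SymplecticForm E M) (f : M → ℝ) (x : M) :
    TangentSpace 𝓘(ℝ, E) x :=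
  (Ω.exists_hamiltonian f x).choose

theorem SymplecticForm.form_hamiltonianField (Ω : SymplecticForm E M) (f : M → ℝ) (x : M)
    (v : TangentSpace 𝓘(ℝ, E) x) :
    Ω.form x v (Ω.hamiltonianField f x) = differential E f x v :=
  (Ω.exists_hamiltonian f x).choose_spec v

theorem SymplecticForm.eq_hamiltonianField (Ω : SymplecticForm E M) (f : M → ℝ) (x : M)
    (X : TangentSpace 𝓘(ℝ, E) x) (hX : ∀ v, Ω.form x v X = differential E f x v) :
    X = Ω.hamiltonianField f x := by
  rw [← sub_eq_zero]
  refine Ω.nondegenerate x _ fun w => ?_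
  rw [Ω.antisymm, map_sub, hX, Ω.form_hamiltonianField, sub_self, neg_zero]

/-- The canonical Poisson bracket `{f, g} = Ω(X_g, X_f)`. -/
def SymplecticForm.bracket (Ω : SymplecticForm E M) (f g : M → ℝ) : M → ℝ :=
  fun x => Ω.form x (Ω.hamiltonianField g x) (Ω.hamiltonianField f x)

/-- `{f, g} = df(X_g)`. -/
theorem SymplecticForm.bracket_eq (Ω : SymplecticForm E M) (f g : M → ℝ) (x : M) :
    Ω.bracket f g x = differential E f x (Ω.hamiltonianField g x) :=
  Ω.form_hamiltonianField f x _

/-- Complete integrability in the noncommutative sense of the Hamiltonian system `ẋ = X_h(x)` on a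
symplectic manifold: there is an algebra `F` of first integrals which is complete, that is,
`ddim F + dind F = dim M`. -/
def SymplecticForm.CompletelyIntegrable (Ω : SymplecticForm E M) (h : M → ℝ) : Prop :=
  ∃ F : Submodule ℝ (M → ℝ), IsAlgebraOfIntegrals E Ω.bracket h F ∧
    ∃ l r : ℕ, HasDdimDind E Ω.bracket (F : Set (M → ℝ)) l r ∧ l + r = Module.finrank ℝ E

end Symplectic

/-! ### Hamiltonian actions and Poisson reduction -/

section Actions

variable {E : Type*} [NormedAddCommGroup E] [NormedSpace ℝ E] [FiniteDimensional ℝ E]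
  {M : Type*} [TopologicalSpace M] [ChartedSpace E M] [IsManifold 𝓘(ℝ, E) ∞ M]
  {E₁ : Type*} [NormedAddCommGroup E₁] [NormedSpace ℝ E₁]
  {G : Type*} [TopologicalSpace G] [ChartedSpace E₁ G] [Group G] [MulAction G M]

/-- `G` acts by symplectomorphisms. -/
def SymplecticForm.IsInvariant (Ω : SymplecticForm E M) (G : Type*) [Group G] [MulAction G M] :
    Prop :=
  ∀ (g : G) (x : M) (u v : TangentSpace 𝓘(ℝ, E) x),
    Ω.form (g • x) (mfderiv 𝓘(ℝ, E) 𝓘(ℝ, E) (fun y : M => g • y) x u)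
      (mfderiv 𝓘(ℝ, E) 𝓘(ℝ, E) (fun y : M => g • y) x v) = Ω.form x u v

/-- The infinitesimal generator `ξ_x = d/dt|_{t=0} exp(tξ) • x`: the image of `ξ ∈ T_1 G` under the
derivative at `1` of the orbit map `g ↦ g • x`. (It lies in the tangent space at `1 • x = x`.) -/
def generator (E : Type*) [NormedAddCommGroup E] [NormedSpace ℝ E]
    {M : Type*} [TopologicalSpace M] [ChartedSpace E M]
    {E₁ : Type*} [NormedAddCommGroup E₁] [NormedSpace ℝ E₁]
    {G : Type*} [TopologicalSpace G] [ChartedSpace E₁ G] [Group G] [MulAction G M]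
    (ξ : GroupLieAlgebra 𝓘(ℝ, E₁) G) (x : M) : TangentSpace 𝓘(ℝ, E) x :=
  mfderiv 𝓘(ℝ, E₁) 𝓘(ℝ, E) (fun g : G => g • x) 1 ξ

/-- `Φ : M → 𝔤^*` is a momentum mapping of the action of `G`: with `φ_ξ(x) = (Φ(x), ξ)`, it is
smooth, the one-parameter subgroup of `ξ` is generated by the Hamiltonian field of `φ_ξ`, and
`φ_[ξ,η] = {φ_ξ, φ_η}`. -/
structure IsMomentumMap (Ω : SymplecticForm E M)
    (Φ : M → Module.Dual ℝ (GroupLieAlgebra 𝓘(ℝ, E₁) G)) : Prop where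
  smooth : ∀ ξ, ContMDiff 𝓘(ℝ, E) 𝓘(ℝ, ℝ) ∞ (fun x => Φ x ξ)
  generator_eq : ∀ ξ x, generator E ξ x = Ω.hamiltonianField (fun y => Φ y ξ) x
  bracket_eq : ∀ ξ η, (fun x => Φ x ⁅ξ, η⁆) = Ω.bracket (fun x => Φ x ξ) (fun x => Φ x η)

/-- The orbit space `M/G`, with the quotient topology. -/
abbrev OrbitSpace (G M : Type*) [Group G] [MulAction G M] : Type _ :=
  Quotient (MulAction.orbitRel G M)

/-- The natural projection `π : M → M/G`. -/
def orbitProj (G : Type*) {M : Type*} [Group G] [MulAction G M] (x : M) : OrbitSpace G M :=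
  Quotient.mk (MulAction.orbitRel G M) x

/-- The function `H` on `M/G` induced by a `G`-invariant function `h` on `M`: `h = H ∘ π`. -/
def reducedFunction (h : M → ℝ) (hinv : ∀ (g : G) (x : M), h (g • x) = h x) :
    OrbitSpace G M → ℝ :=
  Quotient.lift h (by
    rintro a b ⟨g, rfl⟩
    exact hinv g b)

/-- The reduced Poisson bracket on `M/G`: `{F₁, F₂}^G ∘ π = {F₁ ∘ π, F₂ ∘ π}`. It is evaluated
here at some representative of the orbit; `reducedBracket_orbitProj` says that
the choice does not matter. -/
def SymplecticForm.reducedBracket (Ω : SymplecticForm E M) (G : Type*) [Group G] [MulAction G M]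
    (F₁ F₂ : OrbitSpace G M → ℝ) : OrbitSpace G M → ℝ :=
  fun y => Ω.bracket (F₁ ∘ orbitProj G) (F₂ ∘ orbitProj G) y.out

/-- Equivariance of Hamiltonian fields of invariant functions. -/
theorem hamiltonianField_smul (Ω : SymplecticForm E M) (hΩ : Ω.IsInvariant G)
    (hsm : ∀ g : G, ContMDiff 𝓘(ℝ, E) 𝓘(ℝ, E) ∞ (fun y : M => g • y))
    (f : M → ℝ) (hf : ContMDiff 𝓘(ℝ, E) 𝓘(ℝ, ℝ) ∞ f)
    (hinv : ∀ (g : G) (x : M), f (g • x) = f x) (g : G) (x : M) :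
    mfderiv 𝓘(ℝ, E) 𝓘(ℝ, E) (fun y : M => g • y) x (Ω.hamiltonianField f x) =
      Ω.hamiltonianField f (g • x) := by
  have hd : ∀ (g : G) (x : M), MDifferentiableAt 𝓘(ℝ, E) 𝓘(ℝ, E) (fun y : M => g • y) x :=
    fun g x => (hsm g).mdifferentiable (by simp) x
  refine Ω.eq_hamiltonianField f (g • x) _ fun v => ?_
  -- the derivative of the action is surjective
  obtain ⟨u, rfl⟩ : ∃ u : TangentSpace 𝓘(ℝ, E) x,
      mfderiv 𝓘(ℝ, E) 𝓘(ℝ, E) (fun y : M => g • y) x u = v := by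
    have hx : g⁻¹ • g • x = x := inv_smul_smul g x
    have hc : mfderiv 𝓘(ℝ, E) 𝓘(ℝ, E) ((fun y : M => g • y) ∘ fun y : M => g⁻¹ • y) (g • x) =
        ContinuousLinearMap.id ℝ (TangentSpace 𝓘(ℝ, E) (g • x)) := by
      have : ((fun y : M => g • y) ∘ fun y : M => g⁻¹ • y) = id := by
        ext y; simp
      rw [this]
      exact mfderiv_id
    rw [mfderiv_comp (I' := 𝓘(ℝ, E)) (g • x) (hd g _) (hd g⁻¹ _)] at hc
    have hv := DFunLike.congr_fun hc v
    have key : ∀ z : M, z = x → ∀ w : E,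
        (mfderiv 𝓘(ℝ, E) 𝓘(ℝ, E) (fun y : M => g • y) z : E → E) w =
          (mfderiv 𝓘(ℝ, E) 𝓘(ℝ, E) (fun y : M => g • y) x : E → E) w := by
      rintro z rfl w
      rfl
    exact ⟨_, (key _ hx _).symm.trans hv⟩
  rw [hΩ g x, Ω.form_hamiltonianField]
  have hc : f ∘ (fun y : M => g • y) = f := funext fun y => hinv g y
  have hcomp := mfderiv_comp (I' := 𝓘(ℝ, E)) x
    (hf.mdifferentiable (by simp) (g • x)) (hd g x)
  rw [hc] at hcomp
  exact DFunLike.congr_fun hcomp u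

/-- The characteristic property of the reduced bracket: `{F₁, F₂}^G ∘ π = {F₁ ∘ π, F₂ ∘ π}`. -/
theorem reducedBracket_orbitProj (Ω : SymplecticForm E M) (hΩ : Ω.IsInvariant G)
    (hsm : ∀ g : G, ContMDiff 𝓘(ℝ, E) 𝓘(ℝ, E) ∞ (fun y : M => g • y))
    (F₁ F₂ : OrbitSpace G M → ℝ)
    (h₁ : ContMDiff 𝓘(ℝ, E) 𝓘(ℝ, ℝ) ∞ (F₁ ∘ orbitProj G : M → ℝ))
    (h₂ : ContMDiff 𝓘(ℝ, E) 𝓘(ℝ, ℝ) ∞ (F₂ ∘ orbitProj G : M → ℝ)) (x : M) :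
    Ω.reducedBracket G F₁ F₂ (orbitProj G x) =
      Ω.bracket (F₁ ∘ orbitProj G) (F₂ ∘ orbitProj G) x := by
  have hπ : ∀ (g : G) (x : M), orbitProj G (g • x) = orbitProj G x :=
    fun g x => Quotient.sound ⟨g, rfl⟩
  obtain ⟨g, hg⟩ : ∃ g : G, g • x = (orbitProj G x).out :=
    Quotient.exact (Quotient.out_eq (orbitProj G x))
  unfold SymplecticForm.reducedBracket
  rw [← hg]
  unfold SymplecticForm.bracket
  rw [← hamiltonianField_smul Ω hΩ hsm _ h₁ (fun g x => congrArg F₁ (hπ g x)),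
    ← hamiltonianField_smul Ω hΩ hsm _ h₂ (fun g x => congrArg F₂ (hπ g x)), hΩ g x]

/-- `h = H ∘ π`. -/
theorem reducedFunction_orbitProj (h : M → ℝ) (hinv : ∀ (g : G) (x : M), h (g • x) = h x)
    (x : M) : reducedFunction h hinv (orbitProj G x) = h x := rfl

end Actions

end PoissonReduction

end

open PoissonReduction

/-! The lifted algebra consists of the pull-backs of the integrals on M/G together with the
components of the momentum map. It is an algebra of integrals because invariant functions commute
with the momentum map (Noether), so no mixed brackets arise.

Completeness is linear algebra at a single point x. Put T = T_xM with B = Ω_x, let R be the tangent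
space of the orbit, and let A be the space of Hamiltonian vectors of pulled-back integrals. The
Hamiltonian vectors of all invariant functions fill R^⊥ (`range_reducedSharp`). Thus A ≤ R^⊥, and
the kernel of the reduced Poisson structure becomes R^⊥ ∩ R^⊥⊥ = R^⊥ ∩ R. Reduced completeness reads
dim A + dim(A ∩ A^⊥) = dim R^⊥ + dim(R^⊥ ∩ R). The Hamiltonian vectors of the lifted algebra form A
+ R. Clearly A ∩ A^⊥ ≤ (A + R)^⊥; since A ∩ R ≤ R^⊥ ∩ R, the equation forces equality of dimensions
(`finrank_sup_of_complete`). Hence A + R is coisotropic with radical A ∩ A^⊥, which is completeness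
upstairs with the same dind.

That the vectors fill R^⊥ is a dimension count needing dim M ≤ dim M/G + dim G and dim R = dim G.
The first holds because a fibre of π is a smooth image of G (`finrank_le_of_fibre_subset_range`, by
Hausdorff dimension), the second because the action is free (`generatorMap_injective`). -/

namespace PoissonReduction

/-! ### Orthogonals and radicals of a bilinear form -/

section LinearAlgebra

open Module LinearMap.BilinForm

variable {T : Type*} [AddCommGroup T] [Module ℝ T]

/-- If `A` is coisotropic in the reduced sense relative to `R` (that is, `A ≤ R^⊥` satisfies the
completeness equation inside `R^⊥`), then the radical of `A ⊔ R` is the whole of `(A ⊔ R)^⊥` and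
has the same dimension as the radical of `A`. -/
theorem finrank_sup_of_complete [FiniteDimensional ℝ T]
    {B : LinearMap.BilinForm ℝ T} (hB : B.Nondegenerate) (hr : B.IsRefl) {A R : Submodule ℝ T}
    (hAR : A ≤ B.orthogonal R)
    (h : finrank ℝ A + finrank ℝ (A ⊓ B.orthogonal A : Submodule ℝ T) =
      finrank ℝ (B.orthogonal R) +
        finrank ℝ (B.orthogonal R ⊓ B.orthogonal (B.orthogonal R) : Submodule ℝ T)) :
    finrank ℝ (A ⊔ R : Submodule ℝ T) + finrank ℝ (A ⊓ B.orthogonal A : Submodule ℝ T) =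
        finrank ℝ T ∧
      finrank ℝ ((A ⊔ R) ⊓ B.orthogonal (A ⊔ R) : Submodule ℝ T) =
        finrank ℝ (A ⊓ B.orthogonal A : Submodule ℝ T) := by
  have hdim : ∀ W : Submodule ℝ T, finrank ℝ W + finrank ℝ (B.orthogonal W) = finrank ℝ T := by
    intro W
    rw [finrank_add_finrank_orthogonal' , hB.ker_eq_bot]
    simp
  have hle : A ⊓ B.orthogonal A ≤ B.orthogonal (A ⊔ R) := by
    rintro a ⟨ha, ha'⟩
    rw [mem_orthogonal_iff]
    intro n hn
    obtain ⟨b, hb, c, hc, rfl⟩ := Submodule.mem_sup.1 hn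
    have h1 := mem_orthogonal_iff.1 ha' b hb
    have h2 := mem_orthogonal_iff.1 (hAR ha) c hc
    change B (b + c) a = 0
    simp [h1, h2]
  have h1 := Submodule.finrank_mono hle
  have h2 : finrank ℝ (A ⊓ R : Submodule ℝ T) ≤
      finrank ℝ (B.orthogonal R ⊓ B.orthogonal (B.orthogonal R) : Submodule ℝ T) := by
    refine Submodule.finrank_mono ?_
    rw [orthogonal_orthogonal hB hr]
    exact inf_le_inf_right R hAR
  have h3 := Submodule.finrank_sup_add_finrank_inf_eq A R
  have h4 := hdim (A ⊔ R)
  have h5 := hdim R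
  -- The count: dim (A+R)^⊥ = dim R^⊥ − dim A + dim(A ∩ R) ≤ dim R^⊥ + dim(R^⊥ ∩ R^⊥⊥) − dim A =
  -- dim(A ∩ A^⊥), the last step being the completeness hypothesis.
  have h6 : A ⊓ B.orthogonal A = B.orthogonal (A ⊔ R) :=
    Submodule.eq_of_le_of_finrank_le hle (by omega)
  refine ⟨by rw [h6]; exact h4, ?_⟩
  rw [← h6, inf_eq_right.2 (inf_le_left.trans le_sup_left)]

theorem finrank_map_of_injective {W : Type*} [AddCommGroup W] [Module ℝ W] {L : W →ₗ[ℝ] T}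
    (hL : Function.Injective L) (S : Submodule ℝ W) : finrank ℝ (S.map L) = finrank ℝ S :=
  (Submodule.equivMapOfInjective L hL S).finrank_eq.symm

/-- Linearity of `D` is required only on `S`, since differentials are additive only on
differentiable functions. Restricted to `S`, `D` is a genuine linear map, so its image is already a
subspace and each span consists of honest values `D f`. -/
theorem map_span_image_eq_inf_orthogonal {V W : Type*} [AddCommGroup V] [Module ℝ V]
    [AddCommGroup W] [Module ℝ W] (B : LinearMap.BilinForm ℝ T) (S : Submodule ℝ V)
    (D : V → W) (hadd : ∀ f ∈ S, ∀ g ∈ S, D (f + g) = D f + D g)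
    (hsmul : ∀ (c : ℝ), ∀ f ∈ S, D (c • f) = c • D f)
    (L : W →ₗ[ℝ] T) :
    (Submodule.span ℝ (D '' {f | f ∈ S ∧ ∀ g ∈ S, B (L (D g)) (L (D f)) = 0})).map L =
      (Submodule.span ℝ (D '' S)).map L ⊓
        B.orthogonal ((Submodule.span ℝ (D '' S)).map L) := by
  let D' : S →ₗ[ℝ] W :=
    { toFun := fun f => D f
      map_add' := fun f g => hadd f f.2 g g.2
      map_smul' := fun c f => hsmul c f f.2 }
  have hspan : Submodule.span ℝ (D '' S) = LinearMap.range D' := by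
    have : D '' S = (LinearMap.range D' : Set W) := by
      ext w
      simp [D']
    rw [this, Submodule.span_eq]
  rw [hspan]
  apply le_antisymm
  · rw [Submodule.map_span_le]
    rintro _ ⟨f, ⟨hf, hfg⟩, rfl⟩
    refine ⟨⟨_, ⟨⟨f, hf⟩, rfl⟩, rfl⟩, mem_orthogonal_iff.2 ?_⟩
    rintro _ ⟨_, ⟨g, rfl⟩, rfl⟩
    exact hfg g g.2
  · rintro _ ⟨⟨_, ⟨f, rfl⟩, rfl⟩, hf⟩
    refine Submodule.mem_map_of_mem (Submodule.subset_span ⟨f, ⟨f.2, fun g hg => ?_⟩, rfl⟩)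
    exact mem_orthogonal_iff.1 hf _ ⟨_, ⟨⟨g, hg⟩, rfl⟩, rfl⟩

end LinearAlgebra

/-! ### Spans and kernels of differentials -/

section Differentials

variable {E : Type*} [NormedAddCommGroup E] [NormedSpace ℝ E]
  {N : Type*} [TopologicalSpace N] [ChartedSpace E N]

theorem differential_add {f g : N → ℝ} {x : N} (hf : MDifferentiableAt 𝓘(ℝ, E) 𝓘(ℝ, ℝ) f x)
    (hg : MDifferentiableAt 𝓘(ℝ, E) 𝓘(ℝ, ℝ) g x) :
    differential E (f + g) x = differential E f x + differential E g x :=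
  (hf.hasMFDerivAt.add hg.hasMFDerivAt).mfderiv

theorem differential_smul {f : N → ℝ} {x : N} (c : ℝ)
    (hf : MDifferentiableAt 𝓘(ℝ, E) 𝓘(ℝ, ℝ) f x) :
    differential E (c • f) x = c • differential E f x :=
  (hf.hasMFDerivAt.const_smul c).mfderiv

variable {T : Type*} [AddCommGroup T] [Module ℝ T]

/-- Turns the function-theoretic kernel K_x into the radical of a subspace of T, once the bracket is
expressed through `B` and `L`. It serves three times: for the reduced integrals, for all smooth
functions on the quotient, and for the lifted algebra. -/
theorem map_diffKernel (br : (N → ℝ) → (N → ℝ) → N → ℝ) (F : Submodule ℝ (N → ℝ)) (x : N)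
    (hF : ∀ f ∈ F, MDifferentiableAt 𝓘(ℝ, E) 𝓘(ℝ, ℝ) f x) (B : LinearMap.BilinForm ℝ T)
    (L : (TangentSpace 𝓘(ℝ, E) x →L[ℝ] ℝ) →ₗ[ℝ] T)
    (hbr : ∀ f ∈ F, ∀ g ∈ F, br f g x = B (L (differential E g x)) (L (differential E f x))) :
    (diffKernel E br (F : Set (N → ℝ)) x).map L =
      (diffSpan E (F : Set (N → ℝ)) x).map L ⊓
        B.orthogonal ((diffSpan E (F : Set (N → ℝ)) x).map L) := by
  unfold diffKernel diffSpan
  rw [← map_span_image_eq_inf_orthogonal B F (fun f => differential E f x)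
    (fun f hf g hg => differential_add (hF f hf) (hF g hg))
    (fun c f hf => differential_smul c (hF f hf)) L]
  congr 3
  ext f
  refine and_congr_right fun hf => forall₂_congr fun g hg => ?_
  rw [hbr f hf g hg]

/-- `C^∞(N)` as a linear space. -/
def smoothSubmodule (E : Type*) [NormedAddCommGroup E] [NormedSpace ℝ E]
    (N : Type*) [TopologicalSpace N] [ChartedSpace E N] : Submodule ℝ (N → ℝ) where
  carrier := smoothFunctions E N
  add_mem' := fun hf hg => ContMDiff.add hf hg
  zero_mem' := contMDiff_const
  smul_mem' := fun c f (hf : ContMDiff 𝓘(ℝ, E) 𝓘(ℝ, ℝ) ∞ f) => by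
    have hc : ContMDiff 𝓘(ℝ, E) 𝓘(ℝ, ℝ) ∞ fun _ : N => c := contMDiff_const
    exact hc.mul hf

/-- On a Hausdorff manifold every covector is the differential of a smooth function. -/
theorem exists_contMDiff_differential_eq [FiniteDimensional ℝ E] [T2Space N]
    [IsManifold 𝓘(ℝ, E) ∞ N] (x : N) (α : TangentSpace 𝓘(ℝ, E) x →L[ℝ] ℝ) :
    ∃ f : N → ℝ, ContMDiff 𝓘(ℝ, E) 𝓘(ℝ, ℝ) ∞ f ∧ differential E f x = α := by
  let b : SmoothBumpFunction 𝓘(ℝ, E) x :=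
    Classical.choice (SmoothBumpFunction.nhds_basis_support (I := 𝓘(ℝ, E)) (c := x)
      Filter.univ_mem).ex_mem.nonempty
  -- The preferred chart at x has identity derivative at x, so α can be read as a functional on the
  -- model space; composed with the chart and cut off by the bump function, it has differential α.
  have h1 := mfderiv_extChartAt_self (I := 𝓘(ℝ, E)) (x := x)
  let α' : E →L[ℝ] ℝ := α
  refine ⟨fun y => b y • α' (extChartAt 𝓘(ℝ, E) x y), ?_, ?_⟩
  · refine b.contMDiff_smul ?_
    exact α'.contMDiff.comp_contMDiffOn (contMDiffOn_extChartAt)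
  · have hev : (fun y => b y • α' (extChartAt 𝓘(ℝ, E) x y)) =ᶠ[𝓝 x]
        fun y => α' (extChartAt 𝓘(ℝ, E) x y) := by
      filter_upwards [b.eventuallyEq_one] with y hy
      simp [hy]
    unfold differential
    rw [hev.mfderiv_eq]
    have hc : MDifferentiableAt 𝓘(ℝ, E) 𝓘(ℝ, E) (extChartAt 𝓘(ℝ, E) x) x :=
      mdifferentiableAt_extChartAt (mem_chart_source E x)
    have := (α'.hasMFDerivAt (x := extChartAt 𝓘(ℝ, E) x x)).comp x hc.hasMFDerivAt
    refine this.mfderiv.trans ?_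
    simp only [h1]
    rfl

theorem diffSpan_smoothFunctions [FiniteDimensional ℝ E] [T2Space N]
    [IsManifold 𝓘(ℝ, E) ∞ N] (x : N) : diffSpan E (smoothFunctions E N) x = ⊤ := by
  refine eq_top_iff.2 fun α _ => ?_
  obtain ⟨f, hf, rfl⟩ := exists_contMDiff_differential_eq x α
  exact Submodule.subset_span ⟨f, hf, rfl⟩

end Differentials

/-! ### The symplectic form and the isomorphism from covectors to vectors -/

section Bilin

variable {E : Type*} [NormedAddCommGroup E] [NormedSpace ℝ E]
  {M : Type*} [TopologicalSpace M] [ChartedSpace E M] [IsManifold 𝓘(ℝ, E) ∞ M]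

/-- The symplectic form at a point as a bilinear form. -/
noncomputable def SymplecticForm.bilin (Ω : SymplecticForm E M) (x : M) :
    LinearMap.BilinForm ℝ (TangentSpace 𝓘(ℝ, E) x) :=
  LinearMap.mk₂ ℝ (fun u v => Ω.form x u v) (by simp) (by simp) (by simp) (by simp)

@[simp]
theorem SymplecticForm.bilin_apply (Ω : SymplecticForm E M) (x : M)
    (u v : TangentSpace 𝓘(ℝ, E) x) : Ω.bilin x u v = Ω.form x u v := rfl

end Bilin

section Sharp

variable {E : Type*} [NormedAddCommGroup E] [NormedSpace ℝ E] [FiniteDimensional ℝ E]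
  {M : Type*} [TopologicalSpace M] [ChartedSpace E M] [IsManifold 𝓘(ℝ, E) ∞ M]

theorem SymplecticForm.isRefl_bilin (Ω : SymplecticForm E M) (x : M) : (Ω.bilin x).IsRefl := by
  intro u v h
  rw [Ω.bilin_apply, Ω.antisymm, ← Ω.bilin_apply, h, neg_zero]

theorem SymplecticForm.nondegenerate_bilin (Ω : SymplecticForm E M) (x : M) :
    (Ω.bilin x).Nondegenerate := by
  refine (Ω.isRefl_bilin x).nondegenerate_iff_separatingLeft.2 fun u hu => ?_
  exact Ω.nondegenerate x u hu

/-- The linear isomorphism `T^*_x M → T_x M` sending `df(x)` to `X_f(x)`. -/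
theorem SymplecticForm.exists_sharp (Ω : SymplecticForm E M) (x : M) :
    ∃ L : (TangentSpace 𝓘(ℝ, E) x →L[ℝ] ℝ) →ₗ[ℝ] TangentSpace 𝓘(ℝ, E) x,
      Function.Injective L ∧ ∀ α v, Ω.form x v (L α) = α v := by
  have : FiniteDimensional ℝ (TangentSpace 𝓘(ℝ, E) x) :=
    inferInstanceAs (FiniteDimensional ℝ E)
  let φ := (Ω.bilin x).toDual (Ω.nondegenerate_bilin x)
  let L : (TangentSpace 𝓘(ℝ, E) x →L[ℝ] ℝ) →ₗ[ℝ] TangentSpace 𝓘(ℝ, E) x :=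
    -- The sign appears because `toDual` represents α in the first slot of Ω, whereas Hamiltonian
    -- vectors occupy the second.
    -(φ.symm.toLinearMap ∘ₗ ContinuousLinearMap.coeLM ℝ)
  have hL : ∀ α v, Ω.form x v (L α) = α v := by
    intro α v
    rw [Ω.antisymm]
    have : Ω.bilin x (φ.symm (α : TangentSpace 𝓘(ℝ, E) x →ₗ[ℝ] ℝ)) v = α v :=
      LinearMap.BilinForm.apply_toDual_symm_apply (hB := Ω.nondegenerate_bilin x) _ v
    rw [Ω.bilin_apply] at this
    simp [L, this]
  refine ⟨L, fun α β h => ?_, hL⟩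
  ext v
  rw [← hL, h, hL]

/-- See `exists_sharp`. -/
noncomputable def SymplecticForm.sharp (Ω : SymplecticForm E M) (x : M) :
    (TangentSpace 𝓘(ℝ, E) x →L[ℝ] ℝ) →ₗ[ℝ] TangentSpace 𝓘(ℝ, E) x :=
  (Ω.exists_sharp x).choose

theorem SymplecticForm.sharp_injective (Ω : SymplecticForm E M) (x : M) :
    Function.Injective (Ω.sharp x) :=
  (Ω.exists_sharp x).choose_spec.1

theorem SymplecticForm.form_sharp (Ω : SymplecticForm E M) (x : M)
    (α : TangentSpace 𝓘(ℝ, E) x →L[ℝ] ℝ) (v : TangentSpace 𝓘(ℝ, E) x) :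
    Ω.form x v (Ω.sharp x α) = α v :=
  (Ω.exists_sharp x).choose_spec.2 α v

theorem SymplecticForm.sharp_differential (Ω : SymplecticForm E M) (f : M → ℝ) (x : M) :
    Ω.sharp x (differential E f x) = Ω.hamiltonianField f x :=
  Ω.eq_hamiltonianField f x _ fun v => Ω.form_sharp x _ v

theorem SymplecticForm.bracket_eq_bilin (Ω : SymplecticForm E M) (f g : M → ℝ) (x : M) :
    Ω.bracket f g x =
      Ω.bilin x (Ω.sharp x (differential E g x)) (Ω.sharp x (differential E f x)) := by
  rw [Ω.sharp_differential, Ω.sharp_differential, Ω.bilin_apply]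
  rfl

theorem SymplecticForm.bracket_antisymm (Ω : SymplecticForm E M) (f g : M → ℝ) :
    Ω.bracket f g = - Ω.bracket g f :=
  funext fun x => Ω.antisymm x _ _

theorem SymplecticForm.bracket_add_left (Ω : SymplecticForm E M) {f₁ f₂ : M → ℝ} (g : M → ℝ)
    (h₁ : MDifferentiable 𝓘(ℝ, E) 𝓘(ℝ, ℝ) f₁) (h₂ : MDifferentiable 𝓘(ℝ, E) 𝓘(ℝ, ℝ) f₂) :
    Ω.bracket (f₁ + f₂) g = Ω.bracket f₁ g + Ω.bracket f₂ g := by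
  funext x
  rw [Pi.add_apply, Ω.bracket_eq, Ω.bracket_eq, Ω.bracket_eq, differential_add (h₁ x) (h₂ x)]
  rfl

theorem SymplecticForm.bracket_add_right (Ω : SymplecticForm E M) (f : M → ℝ) {g₁ g₂ : M → ℝ}
    (h₁ : MDifferentiable 𝓘(ℝ, E) 𝓘(ℝ, ℝ) g₁) (h₂ : MDifferentiable 𝓘(ℝ, E) 𝓘(ℝ, ℝ) g₂) :
    Ω.bracket f (g₁ + g₂) = Ω.bracket f g₁ + Ω.bracket f g₂ := by
  rw [Ω.bracket_antisymm, Ω.bracket_add_left f h₁ h₂, Ω.bracket_antisymm f g₁,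
    Ω.bracket_antisymm f g₂, neg_add]

end Sharp

/-! ### The infinitesimal action -/

section Generator

variable {E : Type*} [NormedAddCommGroup E] [NormedSpace ℝ E]
  {M : Type*} [TopologicalSpace M] [ChartedSpace E M]
  {E₁ : Type*} [NormedAddCommGroup E₁] [NormedSpace ℝ E₁]
  {G : Type*} [TopologicalSpace G] [ChartedSpace E₁ G] [Group G] [MulAction G M]

/-- The infinitesimal action at `x`, as a linear map. -/
noncomputable def generatorMap (E : Type*) [NormedAddCommGroup E] [NormedSpace ℝ E]
    {M : Type*} [TopologicalSpace M] [ChartedSpace E M]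
    {E₁ : Type*} [NormedAddCommGroup E₁] [NormedSpace ℝ E₁]
    (G : Type*) [TopologicalSpace G] [ChartedSpace E₁ G] [Group G] [MulAction G M] (x : M) :
    GroupLieAlgebra 𝓘(ℝ, E₁) G →ₗ[ℝ] TangentSpace 𝓘(ℝ, E) x where
  toFun ξ := generator E ξ x
  map_add' := (mfderiv 𝓘(ℝ, E₁) 𝓘(ℝ, E) (fun g : G => g • x) 1).map_add
  map_smul' := (mfderiv 𝓘(ℝ, E₁) 𝓘(ℝ, E) (fun g : G => g • x) 1).map_smul

@[simp]
theorem generatorMap_apply (ξ : GroupLieAlgebra 𝓘(ℝ, E₁) G) (x : M) :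
    generatorMap E G x ξ = generator E ξ x := rfl

variable [ContMDiffSMul 𝓘(ℝ, E₁) 𝓘(ℝ, E) ∞ G M]

theorem contMDiff_orbitMap (x : M) :
    ContMDiff 𝓘(ℝ, E₁) 𝓘(ℝ, E) ∞ (fun g : G => g • x) :=
  contMDiff_id.smul contMDiff_const

theorem contMDiff_smul_left (E₁ : Type*) [NormedAddCommGroup E₁] [NormedSpace ℝ E₁]
    [ChartedSpace E₁ G] [ContMDiffSMul 𝓘(ℝ, E₁) 𝓘(ℝ, E) ∞ G M] (g : G) :
    ContMDiff 𝓘(ℝ, E) 𝓘(ℝ, E) ∞ (fun y : M => g • y) :=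
  (contMDiff_const (I' := 𝓘(ℝ, E₁))).smul contMDiff_id

/-- Along the orbit map f is constant; differentiate at 1. With f = π this gives orthogonality to
the orbit, with f real-valued it gives Noether's theorem. -/
theorem mfderiv_generator_eq_zero {E' : Type*} [NormedAddCommGroup E'] [NormedSpace ℝ E']
    {N : Type*} [TopologicalSpace N] [ChartedSpace E' N] {f : M → N} {x : M}
    (hf : MDifferentiableAt 𝓘(ℝ, E) 𝓘(ℝ, E') f x) (hinv : ∀ g : G, f (g • x) = f x)
    (ξ : GroupLieAlgebra 𝓘(ℝ, E₁) G) :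
    mfderiv 𝓘(ℝ, E) 𝓘(ℝ, E') f x (generator E ξ x) = 0 := by
  have hf1 : MDifferentiableAt 𝓘(ℝ, E) 𝓘(ℝ, E') f ((1 : G) • x) := by rwa [one_smul]
  have hcomp := mfderiv_comp (I' := 𝓘(ℝ, E)) (1 : G) hf1
    ((contMDiff_orbitMap (E₁ := E₁) x).mdifferentiable (by simp) 1)
  have hconst : f ∘ (fun g : G => g • x) = fun _ => f x := funext hinv
  rw [hconst, mfderiv_const] at hcomp
  have h0 := DFunLike.congr_fun hcomp ξ
  -- The base points `1 • x` and `x` are only propositionally equal, so the two derivatives are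
  -- compared as maps of model spaces.
  have key : ∀ z : M, z = x → ∀ w : E,
      (mfderiv 𝓘(ℝ, E) 𝓘(ℝ, E') f z : E → E') w = (mfderiv 𝓘(ℝ, E) 𝓘(ℝ, E') f x : E → E') w := by
    rintro z rfl w
    rfl
  exact (key _ (one_smul G x) _).symm.trans h0.symm

end Generator

/-- A curve in a manifold whose derivative vanishes near a point is locally constant there. -/
theorem eventually_eq_of_hasMFDerivAt_zero {E : Type*} [NormedAddCommGroup E] [NormedSpace ℝ E]
    {M : Type*} [TopologicalSpace M] [ChartedSpace E M] [IsManifold 𝓘(ℝ, E) ∞ M]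
    {c : ℝ → M} {t₀ : ℝ} (hc : ∀ᶠ t in 𝓝 t₀, HasMFDerivAt 𝓘(ℝ, ℝ) 𝓘(ℝ, E) c t 0) :
    ∀ᶠ t in 𝓝 t₀, c t = c t₀ := by
  have : IsManifold 𝓘(ℝ, E) 1 M := IsManifold.of_le (n := ∞) (by simp)
  have hsrc : ∀ᶠ t in 𝓝 t₀, c t ∈ (chartAt E (c t₀)).source :=
    hc.self_of_nhds.continuousAt.eventually_mem
      ((chartAt E (c t₀)).open_source.mem_nhds (mem_chart_source E _))
  obtain ⟨ε, hε, hball⟩ := Metric.eventually_nhds_iff_ball.1 (hc.and hsrc)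
  filter_upwards [Metric.ball_mem_nhds t₀ hε] with t ht
  let φ := extChartAt 𝓘(ℝ, E) (c t₀)
  have hder : ∀ s ∈ Metric.ball t₀ ε, HasFDerivAt (φ ∘ c) (0 : ℝ →L[ℝ] E) s := by
    intro s hs
    have h1 := (mdifferentiableAt_extChartAt (I := 𝓘(ℝ, E)) (hball s hs).2).hasMFDerivAt.comp s
      (hball s hs).1
    rw [ContinuousLinearMap.comp_zero] at h1
    exact h1.hasFDerivAt
  have heq : φ (c t) = φ (c t₀) :=
    (convex_ball t₀ ε).is_const_of_fderivWithin_eq_zero (𝕜 := ℝ) (f := φ ∘ c)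
      (fun s hs => (hder s hs).differentiableAt.differentiableWithinAt)
      (fun s hs => (hder s hs).hasFDerivWithinAt.fderivWithin
        (Metric.isOpen_ball.uniqueDiffWithinAt hs)) ht (Metric.mem_ball_self hε)
  refine φ.injOn ?_ ?_ heq
  · rw [extChartAt_source]
    exact (hball t ht).2
  · exact mem_extChartAt_source _

/-! ### Injectivity of the infinitesimal action of a free action -/

section FreeAction

variable {E : Type*} [NormedAddCommGroup E] [NormedSpace ℝ E]
  {M : Type*} [TopologicalSpace M] [ChartedSpace E M]
  {E₁ : Type*} [NormedAddCommGroup E₁] [NormedSpace ℝ E₁]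
  {G : Type*} [TopologicalSpace G] [ChartedSpace E₁ G] [Group G] [LieGroup 𝓘(ℝ, E₁) ∞ G]
  [MulAction G M] [ContMDiffSMul 𝓘(ℝ, E₁) 𝓘(ℝ, E) ∞ G M]

/-- The derivative of the orbit map along a left invariant vector field vanishes as soon as the
infinitesimal generator vanishes at the base point. -/
theorem mfderiv_orbitMap_mulInvariantVectorField_eq_zero {x : M}
    {ξ : GroupLieAlgebra 𝓘(ℝ, E₁) G} (hξ : generator E ξ x = 0) (g : G) :
    mfderiv 𝓘(ℝ, E₁) 𝓘(ℝ, E) (fun k : G => k • x) g (mulInvariantVectorField ξ g) = 0 := by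
  have ho : MDifferentiable 𝓘(ℝ, E₁) 𝓘(ℝ, E) (fun k : G => k • x) :=
    (contMDiff_orbitMap x).mdifferentiable (by simp)
  have hl : MDifferentiable 𝓘(ℝ, E₁) 𝓘(ℝ, E₁) (fun k : G => g * k) :=
    (contMDiff_mul_left (I := 𝓘(ℝ, E₁)) (n := ∞)).mdifferentiable (by simp)
  have hs : MDifferentiable 𝓘(ℝ, E) 𝓘(ℝ, E) (fun y : M => g • y) :=
    (contMDiff_smul_left E₁ g).mdifferentiable (by simp)
  have h1 := mfderiv_comp (1 : G) (ho (g * 1)) (hl 1)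
  have h2 := mfderiv_comp (1 : G) (hs ((1 : G) • x)) (ho 1)
  -- Equivariance of the orbit map: differentiating (gk)x = g(kx) at k = 1 moves the vanishing of
  -- the generator from 1 to g.
  have h12 : (fun k : G => k • x) ∘ (fun k : G => g * k) =
      (fun y : M => g • y) ∘ fun k : G => k • x := by
    funext k
    simp [mul_smul]
  rw [h12, h2] at h1
  have h3 := DFunLike.congr_fun h1 ξ
  have h4 : (mfderiv 𝓘(ℝ, E) 𝓘(ℝ, E) (fun y : M => g • y) ((1 : G) • x))
      (mfderiv 𝓘(ℝ, E₁) 𝓘(ℝ, E) (fun k : G => k • x) 1 ξ) = 0 := by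
    refine (congrArg _ hξ).trans (map_zero _)
  have key : ∀ z : G, z = g → ∀ w : E₁,
      (mfderiv 𝓘(ℝ, E₁) 𝓘(ℝ, E) (fun k : G => k • x) z : E₁ → E) w =
        (mfderiv 𝓘(ℝ, E₁) 𝓘(ℝ, E) (fun k : G => k • x) g : E₁ → E) w := by
    rintro z rfl w
    rfl
  exact (key _ (mul_one g) _).symm.trans (h3.symm.trans h4)

/-- The infinitesimal action of a free action is injective. -/
theorem generatorMap_injective [CompleteSpace E₁] [T2Space G] [IsManifold 𝓘(ℝ, E) ∞ M]
    [IsCancelSMul G M] (x : M) : Function.Injective (generatorMap E (E₁ := E₁) G x) := by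
  have : LieGroup 𝓘(ℝ, E₁) (minSmoothness ℝ 3) G := LieGroup.of_le (n := ∞) (by
    rw [minSmoothness_of_isRCLikeNormedField]
    exact ENat.LEInfty.out)
  have : IsManifold 𝓘(ℝ, E₁) 1 G := IsManifold.of_le (n := ∞) (by simp)
  rw [← LinearMap.ker_eq_bot, LinearMap.ker_eq_bot']
  intro ξ hξ
  have hv : ContMDiffAt 𝓘(ℝ, E₁) 𝓘(ℝ, E₁).tangent 1
      (fun g => (⟨g, mulInvariantVectorField ξ g⟩ : TangentBundle 𝓘(ℝ, E₁) G)) (1 : G) :=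
    (contMDiffAt_mulInvariantVectorField ξ).of_le (by simp)
  -- An integral curve of the left invariant field of ξ through 1. If ξ generates zero at x, then
  -- γ(t)x is stationary; freeness then makes γ itself stationary near 0, and its initial velocity ξ
  -- vanishes.
  obtain ⟨γ, hγ1, hγ⟩ := exists_isMIntegralCurveAt_of_contMDiffAt_boundaryless 0 hv
  have hc : ∀ᶠ t in 𝓝 (0 : ℝ), HasMFDerivAt 𝓘(ℝ, ℝ) 𝓘(ℝ, E) (fun t => γ t • x) t 0 := by
    filter_upwards [hγ] with t ht
    have h1 := (((contMDiff_orbitMap (E := E) (E₁ := E₁) x).mdifferentiable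
      (by simp)) (γ t)).hasMFDerivAt.comp t ht
    refine HasMFDerivAt.congr_mfderiv h1 ?_
    ext
    refine (congrArg (mfderiv 𝓘(ℝ, E₁) 𝓘(ℝ, E) (fun k : G => k • x) (γ t))
      (one_smul ℝ (mulInvariantVectorField ξ (γ t)))).trans ?_
    exact mfderiv_orbitMap_mulInvariantVectorField_eq_zero hξ (γ t)
  have hconst : γ =ᶠ[𝓝 0] fun _ => 1 := by
    filter_upwards [eventually_eq_of_hasMFDerivAt_zero hc] with t ht
    rw [hγ1] at ht
    exact IsCancelSMul.right_cancel _ _ _ ht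
  have h0 := hasMFDerivAt_unique hγ.hasMFDerivAt
    ((hasMFDerivAt_const (1 : G) (0 : ℝ)).congr_of_eventuallyEq hconst)
  have h1 : mulInvariantVectorField ξ (γ 0) = 0 := by
    exact (one_smul ℝ _).symm.trans (DFunLike.congr_fun h0 (1 : ℝ))
  rw [hγ1] at h1
  have h2 : (fun k : G => 1 * k) = id := by funext k; simp
  unfold mulInvariantVectorField at h1
  rw [h2, mfderiv_id] at h1
  exact h1

end FreeAction

/-! ### Submersions and the dimension of their fibres -/

section Dimension

open Set Module

/-- The image of a smooth map defined on an open subset of a second countable manifold has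
Hausdorff dimension at most the dimension of the manifold. -/
theorem dimH_image_le_of_contMDiffOn {E₁ : Type*} [NormedAddCommGroup E₁] [NormedSpace ℝ E₁]
    [FiniteDimensional ℝ E₁] {N : Type*} [TopologicalSpace N] [SecondCountableTopology N]
    [ChartedSpace E₁ N] [IsManifold 𝓘(ℝ, E₁) ∞ N]
    {F : Type*} [NormedAddCommGroup F] [NormedSpace ℝ F]
    {f : N → F} {O : Set N} (hO : IsOpen O) (hf : ContMDiffOn 𝓘(ℝ, E₁) 𝓘(ℝ, F) ∞ f O) :
    dimH (f '' O) ≤ finrank ℝ E₁ := by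
  have hloc : ∀ g ∈ O, ∃ t ∈ 𝓝[O] g, dimH (f '' t) ≤ finrank ℝ E₁ := by
    intro g hg
    let φ := chartAt E₁ g
    have hmem : φ.symm ⁻¹' O ∩ φ.target ∈ 𝓝 (φ g) := by
      refine Filter.inter_mem ?_ (φ.open_target.mem_nhds (mem_chart_target E₁ g))
      refine (φ.continuousAt_symm (mem_chart_target E₁ g)).preimage_mem_nhds ?_
      rw [φ.left_inv (mem_chart_source E₁ g)]
      exact hO.mem_nhds hg
    obtain ⟨ε, hε, hball⟩ := Metric.mem_nhds_iff.1 hmem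
    have hsm : ContDiffOn ℝ 1 (f ∘ φ.symm) (Metric.ball (φ g) ε) := by
      have h1 : ContMDiffOn 𝓘(ℝ, E₁) 𝓘(ℝ, E₁) ∞ φ.symm φ.target :=
        contMDiffOn_symm_of_mem_maximalAtlas (IsManifold.chart_mem_maximalAtlas g)
      have h2 : ContMDiffOn 𝓘(ℝ, E₁) 𝓘(ℝ, F) ∞ (f ∘ φ.symm) (Metric.ball (φ g) ε) :=
        hf.comp (h1.mono fun y hy => (hball hy).2) fun y hy => (hball hy).1
      exact h2.contDiffOn.of_le (by simp)
    refine ⟨φ.source ∩ φ ⁻¹' Metric.ball (φ g) ε, mem_nhdsWithin_of_mem_nhds ?_, ?_⟩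
    · exact Filter.inter_mem (φ.open_source.mem_nhds (mem_chart_source E₁ g))
        ((φ.continuousAt (mem_chart_source E₁ g)).preimage_mem_nhds (Metric.ball_mem_nhds _ hε))
    · calc dimH (f '' (φ.source ∩ φ ⁻¹' Metric.ball (φ g) ε))
          ≤ dimH ((f ∘ φ.symm) '' Metric.ball (φ g) ε) := by
            refine dimH_mono ?_
            rintro _ ⟨k, ⟨hk, hk'⟩, rfl⟩
            exact ⟨φ k, hk', congrArg f (φ.left_inv hk)⟩
        _ ≤ dimH (Metric.ball (φ g) ε) := hsm.dimH_image_le (convex_ball _ _) le_rfl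
        _ ≤ dimH (univ : Set E₁) := dimH_mono (subset_univ _)
        _ = finrank ℝ E₁ := Real.dimH_univ_eq_finrank E₁
  choose! t ht hdim using hloc
  -- Second countability reduces the local bound to countably many pieces, and Hausdorff dimension
  -- of a countable union is a supremum.
  obtain ⟨u, huO, huc, hu⟩ := TopologicalSpace.countable_cover_nhdsWithin ht
  calc dimH (f '' O) ≤ dimH (⋃ g ∈ u, f '' t g) := by
        refine dimH_mono ?_
        rw [← image_iUnion₂]
        exact image_mono hu
    _ = ⨆ g ∈ u, dimH (f '' t g) := dimH_bUnion huc _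
    _ ≤ finrank ℝ E₁ := iSup₂_le fun g hg => hdim g (huO hg)

variable {E : Type*} [NormedAddCommGroup E] [NormedSpace ℝ E]
  {M : Type*} [TopologicalSpace M] [ChartedSpace E M]
  {E₂ : Type*} [NormedAddCommGroup E₂] [NormedSpace ℝ E₂]
  {Q : Type*} [TopologicalSpace Q] [ChartedSpace E₂ Q]
  {F : Type*} [NormedAddCommGroup F] [NormedSpace ℝ F]
  {p : M → Q} {x : M}

/-- In adapted charts p is a linear projection, and the derivatives of the charts are bijective. -/
theorem mfderiv_surjective_of_isSubmersionAt [IsManifold 𝓘(ℝ, E) ∞ M]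
    [IsManifold 𝓘(ℝ, E₂) ∞ Q]
    (h : Manifold.IsSubmersionAtOfComplement F 𝓘(ℝ, E) 𝓘(ℝ, E₂) ∞ p x) :
    Function.Surjective (mfderiv 𝓘(ℝ, E) 𝓘(ℝ, E₂) p x) := by
  have : IsManifold 𝓘(ℝ, E) 1 M := IsManifold.of_le (n := ∞) (by simp)
  have : IsManifold 𝓘(ℝ, E₂) 1 Q := IsManifold.of_le (n := ∞) (by simp)
  have he : h.domChart.MDifferentiable 𝓘(ℝ, E) 𝓘(ℝ, E) :=
    ⟨(contMDiffOn_of_mem_maximalAtlas h.domChart_mem_maximalAtlas).mdifferentiableOn (by simp),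
      (contMDiffOn_symm_of_mem_maximalAtlas
        h.domChart_mem_maximalAtlas).mdifferentiableOn (by simp)⟩
  have hψ : h.codChart.MDifferentiable 𝓘(ℝ, E₂) 𝓘(ℝ, E₂) :=
    ⟨(contMDiffOn_of_mem_maximalAtlas h.codChart_mem_maximalAtlas).mdifferentiableOn (by simp),
      (contMDiffOn_symm_of_mem_maximalAtlas
        h.codChart_mem_maximalAtlas).mdifferentiableOn (by simp)⟩
  have hp : MDifferentiableAt 𝓘(ℝ, E) 𝓘(ℝ, E₂) p x := h.contMDiffAt.mdifferentiableAt (by simp)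
  have heq : h.codChart ∘ p =ᶠ[𝓝 x]
      (ContinuousLinearMap.fst ℝ E₂ F ∘L (h.equiv : E →L[ℝ] E₂ × F)) ∘ h.domChart := by
    filter_upwards [h.domChart.open_source.mem_nhds h.mem_domChart_source] with y hy
    have hmem : h.domChart y ∈ (h.domChart.extend 𝓘(ℝ, E)).target := by
      simpa using h.domChart.map_source hy
    have := h.writtenInCharts hmem
    simpa [h.domChart.left_inv hy] using this
  have h1 := (hψ.mdifferentiableAt h.mem_codChart_source).hasMFDerivAt.comp x hp.hasMFDerivAt
  have h2 := (ContinuousLinearMap.hasMFDerivAt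
    (ContinuousLinearMap.fst ℝ E₂ F ∘L (h.equiv : E →L[ℝ] E₂ × F))
    (x := h.domChart x)).comp x (he.mdifferentiableAt h.mem_domChart_source).hasMFDerivAt
  have h3 := hasMFDerivAt_unique (h1.congr_of_eventuallyEq heq.symm) h2
  intro w
  obtain ⟨v, hv⟩ := he.mfderiv_surjective h.mem_domChart_source
    (h.equiv.symm (mfderiv 𝓘(ℝ, E₂) 𝓘(ℝ, E₂) h.codChart (p x) w, 0))
  refine ⟨v, hψ.mfderiv_injective h.mem_codChart_source ?_⟩
  refine (DFunLike.congr_fun h3 v).trans ?_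
  change (h.equiv (mfderiv 𝓘(ℝ, E) 𝓘(ℝ, E) h.domChart x v)).1 = _
  rw [hv]
  exact congrArg Prod.fst (h.equiv.apply_symm_apply _)

/-- If a fibre of a submersion is the image of a smooth map from a second countable manifold,
then its dimension is at most the dimension of that manifold. -/
theorem finrank_le_of_fibre_subset_range [FiniteDimensional ℝ E]
    {E₁ : Type*} [NormedAddCommGroup E₁] [NormedSpace ℝ E₁]
    [FiniteDimensional ℝ E₁] {N : Type*} [TopologicalSpace N] [SecondCountableTopology N]
    [ChartedSpace E₁ N] [IsManifold 𝓘(ℝ, E₁) ∞ N]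
    (h : Manifold.IsSubmersionAtOfComplement F 𝓘(ℝ, E) 𝓘(ℝ, E₂) ∞ p x)
    {o : N → M} (ho : ContMDiff 𝓘(ℝ, E₁) 𝓘(ℝ, E) ∞ o) (hrange : p ⁻¹' {p x} ⊆ range o) :
    finrank ℝ E ≤ finrank ℝ E₂ + finrank ℝ E₁ := by
  let e := h.domChart
  have : FiniteDimensional ℝ (E₂ × F) := h.equiv.toLinearEquiv.finiteDimensional
  have : FiniteDimensional ℝ E₂ :=
    Module.Finite.of_surjective (LinearMap.fst ℝ E₂ F) LinearMap.fst_surjective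
  have : FiniteDimensional ℝ F :=
    Module.Finite.of_surjective (LinearMap.snd ℝ E₂ F) LinearMap.snd_surjective
  have hE : finrank ℝ E = finrank ℝ E₂ + finrank ℝ F := by
    rw [h.equiv.toLinearEquiv.finrank_eq, finrank_prod]
  let O : Set N := o ⁻¹' e.source
  have hO : IsOpen O := e.open_source.preimage ho.continuous
  -- The fibre coordinate of `o` in the adapted chart.
  let q : N → F := fun k => (h.equiv (e (o k))).2
  have hq : ContMDiffOn 𝓘(ℝ, E₁) 𝓘(ℝ, F) ∞ q O := by
    have h1 : ContMDiffOn 𝓘(ℝ, E₁) 𝓘(ℝ, E) ∞ (e ∘ o) O :=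
      (contMDiffOn_of_mem_maximalAtlas h.domChart_mem_maximalAtlas).comp ho.contMDiffOn
        fun _ hk => hk
    exact (ContinuousLinearMap.snd ℝ E₂ F ∘L
      (h.equiv : E →L[ℝ] E₂ × F)).contMDiff.comp_contMDiffOn h1
  -- Points of the chart sharing the base coordinate of x lie in the fibre through x, hence in the
  -- range of `o`. So `q` hits every fibre coordinate near that of x, and its image has full
  -- Hausdorff dimension dim F.
  have hnhds : q '' O ∈ 𝓝 (h.equiv (e x)).2 := by
    have hcont : Continuous fun v : F => h.equiv.symm ((h.equiv (e x)).1, v) := by fun_prop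
    have hmem : (fun v : F => h.equiv.symm ((h.equiv (e x)).1, v)) ⁻¹' e.target ∈
        𝓝 (h.equiv (e x)).2 := by
      refine hcont.continuousAt.preimage_mem_nhds (e.open_target.mem_nhds ?_)
      simpa using e.map_source h.mem_domChart_source
    filter_upwards [hmem] with v hv
    have hv' : h.equiv.symm ((h.equiv (e x)).1, v) ∈ e.target := hv
    have hy := e.map_target hv'
    have hfib : ∀ y ∈ e.source, h.codChart (p y) = (h.equiv (e y)).1 := by
      intro y hy
      have hmem : e y ∈ (e.extend 𝓘(ℝ, E)).target := by simpa using e.map_source hy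
      have := h.writtenInCharts hmem
      simpa [e, h.domChart.left_inv hy] using this
    have hpy : p (e.symm (h.equiv.symm ((h.equiv (e x)).1, v))) = p x := by
      refine h.codChart.injOn (h.source_subset_preimage_source hy) h.mem_codChart_source ?_
      rw [hfib _ hy, hfib _ h.mem_domChart_source, e.right_inv hv']
      simp
    obtain ⟨k, hk⟩ := hrange hpy
    refine ⟨k, ?_, ?_⟩
    · change o k ∈ e.source
      rwa [hk]
    · simp [q, hk, e.right_inv hv']
  have := dimH_image_le_of_contMDiffOn hO hq
  rw [Real.dimH_of_mem_nhds hnhds] at this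
  rw [hE]
  gcongr
  exact_mod_cast this

end Dimension

theorem diffSpan_sup {E : Type*} [NormedAddCommGroup E] [NormedSpace ℝ E]
    {N : Type*} [TopologicalSpace N] [ChartedSpace E N] (F₁ F₂ : Submodule ℝ (N → ℝ)) (x : N)
    (h₁ : ∀ f ∈ F₁, MDifferentiableAt 𝓘(ℝ, E) 𝓘(ℝ, ℝ) f x)
    (h₂ : ∀ f ∈ F₂, MDifferentiableAt 𝓘(ℝ, E) 𝓘(ℝ, ℝ) f x) :
    diffSpan E (F₁ ⊔ F₂ : Submodule ℝ (N → ℝ)) x =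
      diffSpan E (F₁ : Set (N → ℝ)) x ⊔ diffSpan E (F₂ : Set (N → ℝ)) x := by
  unfold diffSpan
  apply le_antisymm
  · rw [Submodule.span_le]
    rintro _ ⟨f, hf, rfl⟩
    obtain ⟨a, ha, b, hb, rfl⟩ := Submodule.mem_sup.1 hf
    change differential E (a + b) x ∈ _
    rw [differential_add (h₁ a ha) (h₂ b hb)]
    exact Submodule.add_mem_sup (Submodule.subset_span ⟨a, ha, rfl⟩)
      (Submodule.subset_span ⟨b, hb, rfl⟩)
  · refine sup_le (Submodule.span_mono (Set.image_mono ?_))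
      (Submodule.span_mono (Set.image_mono ?_))
    · exact SetLike.coe_subset_coe.2 le_sup_left
    · exact SetLike.coe_subset_coe.2 le_sup_right

theorem finrank_cotangent {E : Type*} [NormedAddCommGroup E] [NormedSpace ℝ E]
    [FiniteDimensional ℝ E] : Module.finrank ℝ (E →L[ℝ] ℝ) = Module.finrank ℝ E := by
  rw [← Subspace.dual_finrank_eq (V := E)]
  exact (LinearMap.toContinuousLinearMap (𝕜 := ℝ) (E := E) (F' := ℝ)).finrank_eq.symm

theorem orbitProj_smul {G M : Type*} [Group G] [MulAction G M] (g : G) (x : M) :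
    orbitProj G (g • x) = orbitProj G x :=
  Quotient.sound ⟨g, rfl⟩

/-! ### Hamiltonian vectors of invariant functions -/

section Reduction

open Module

variable {E E₁ E₂ : Type*}
  [NormedAddCommGroup E] [NormedSpace ℝ E] [FiniteDimensional ℝ E]
  [NormedAddCommGroup E₁] [NormedSpace ℝ E₁]
  [NormedAddCommGroup E₂] [NormedSpace ℝ E₂]
  {M : Type*} [TopologicalSpace M] [ChartedSpace E M] [IsManifold 𝓘(ℝ, E) ∞ M]
  (Ω : SymplecticForm E M)
  {G : Type*} [Group G] [MulAction G M]
  [ChartedSpace E₂ (OrbitSpace G M)]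

/-- The map `T^*_{π(x)}(M/G) → T_x M` sending `dF(π(x))` to `X_{F ∘ π}(x)`. -/
noncomputable def SymplecticForm.reducedSharp (E₂ : Type*) [NormedAddCommGroup E₂]
    [NormedSpace ℝ E₂] (G : Type*) [Group G] [MulAction G M] [ChartedSpace E₂ (OrbitSpace G M)]
    (x : M) : (TangentSpace 𝓘(ℝ, E₂) (orbitProj G x) →L[ℝ] ℝ) →ₗ[ℝ] TangentSpace 𝓘(ℝ, E) x where
  toFun α := Ω.sharp x (α ∘L mfderiv 𝓘(ℝ, E) 𝓘(ℝ, E₂) (orbitProj G : M → OrbitSpace G M) x)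
  map_add' α β := by rw [ContinuousLinearMap.add_comp, map_add]
  map_smul' c α := by rw [ContinuousLinearMap.smul_comp, map_smul, RingHom.id_apply]

theorem SymplecticForm.reducedSharp_apply (x : M)
    (α : TangentSpace 𝓘(ℝ, E₂) (orbitProj G x) →L[ℝ] ℝ) :
    Ω.reducedSharp E₂ G x α =
      Ω.sharp x (α ∘L mfderiv 𝓘(ℝ, E) 𝓘(ℝ, E₂) (orbitProj G : M → OrbitSpace G M) x) := rfl

variable {Ω}

/-- Pull-back of covectors along the surjective dπ is injective. -/
theorem SymplecticForm.reducedSharp_injective [IsManifold 𝓘(ℝ, E₂) ∞ (OrbitSpace G M)]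
    (hπ : Manifold.IsSubmersion 𝓘(ℝ, E) 𝓘(ℝ, E₂) ∞ (orbitProj G : M → OrbitSpace G M))
    (x : M) :
    Function.Injective (Ω.reducedSharp E₂ G x) := by
  intro α β h
  have h1 := Ω.sharp_injective x h
  ext w
  obtain ⟨v, rfl⟩ := mfderiv_surjective_of_isSubmersionAt
    (hπ.isSubmersionOfComplement_complement x) w
  exact DFunLike.congr_fun h1 v

theorem SymplecticForm.reducedSharp_differential
    (hπ : Manifold.IsSubmersion 𝓘(ℝ, E) 𝓘(ℝ, E₂) ∞ (orbitProj G : M → OrbitSpace G M))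
    {F : OrbitSpace G M → ℝ}
    (hF : ContMDiff 𝓘(ℝ, E₂) 𝓘(ℝ, ℝ) ∞ F) (x : M) :
    Ω.reducedSharp E₂ G x (differential E₂ F (orbitProj G x)) =
      Ω.sharp x (differential E (F ∘ orbitProj G) x) := by
  have h : differential E (F ∘ orbitProj G) x = differential E₂ F (orbitProj G x) ∘L
      mfderiv 𝓘(ℝ, E) 𝓘(ℝ, E₂) (orbitProj G : M → OrbitSpace G M) x :=
    mfderiv_comp x (hF.mdifferentiable (by simp) _) (hπ.contMDiff.mdifferentiable (by simp) _)
  rw [Ω.reducedSharp_apply, h]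

/-- The reduced Poisson tensor at π(x) can thus be studied inside the single symplectic space T_xM.
-/
theorem reducedBracket_eq_bilin [TopologicalSpace G] [ChartedSpace E₁ G]
    [ContMDiffSMul 𝓘(ℝ, E₁) 𝓘(ℝ, E) ∞ G M] (hΩ : Ω.IsInvariant G)
    (hπ : Manifold.IsSubmersion 𝓘(ℝ, E) 𝓘(ℝ, E₂) ∞ (orbitProj G : M → OrbitSpace G M))
    {F₁ F₂ : OrbitSpace G M → ℝ}
    (h₁ : ContMDiff 𝓘(ℝ, E₂) 𝓘(ℝ, ℝ) ∞ F₁) (h₂ : ContMDiff 𝓘(ℝ, E₂) 𝓘(ℝ, ℝ) ∞ F₂) (x : M) :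
    Ω.reducedBracket G F₁ F₂ (orbitProj G x) =
      Ω.bilin x (Ω.reducedSharp E₂ G x (differential E₂ F₂ (orbitProj G x)))
        (Ω.reducedSharp E₂ G x (differential E₂ F₁ (orbitProj G x))) := by
  rw [reducedBracket_orbitProj Ω hΩ (contMDiff_smul_left E₁) F₁ F₂ (h₁.comp hπ.contMDiff)
    (h₂.comp hπ.contMDiff), Ω.bracket_eq_bilin, Ω.reducedSharp_differential hπ h₁,
    Ω.reducedSharp_differential hπ h₂]

/-- The Hamiltonian vectors of invariant functions fill the symplectic orthogonal of the tangent
space of the orbit. -/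
theorem SymplecticForm.range_reducedSharp [FiniteDimensional ℝ E₁] [TopologicalSpace G]
    [ChartedSpace E₁ G] [T2Space G] [SecondCountableTopology G]
    [LieGroup 𝓘(ℝ, E₁) ∞ G] [ContMDiffSMul 𝓘(ℝ, E₁) 𝓘(ℝ, E) ∞ G M] [IsCancelSMul G M]
    [IsManifold 𝓘(ℝ, E₂) ∞ (OrbitSpace G M)]
    (hπ : Manifold.IsSubmersion 𝓘(ℝ, E) 𝓘(ℝ, E₂) ∞ (orbitProj G : M → OrbitSpace G M))
    (x : M) :
    LinearMap.range (Ω.reducedSharp E₂ G x) =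
      (Ω.bilin x).orthogonal (LinearMap.range (generatorMap E (E₁ := E₁) G x)) := by
  have : FiniteDimensional ℝ (TangentSpace 𝓘(ℝ, E) x) := inferInstanceAs (FiniteDimensional ℝ E)
  have hsub := hπ.isSubmersionOfComplement_complement x
  have : FiniteDimensional ℝ E₂ := by
    have := hsub.equiv.toLinearEquiv.finiteDimensional
    exact Module.Finite.of_surjective (LinearMap.fst ℝ E₂ hπ.complement) LinearMap.fst_surjective
  refine Submodule.eq_of_le_of_finrank_le ?_ ?_
  · rintro _ ⟨α, rfl⟩
    refine LinearMap.BilinForm.mem_orthogonal_iff.2 ?_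
    rintro _ ⟨ξ, rfl⟩
    change Ω.form x _ _ = 0
    rw [Ω.reducedSharp_apply, Ω.form_sharp, ContinuousLinearMap.comp_apply, generatorMap_apply,
      mfderiv_generator_eq_zero (hπ.contMDiff.mdifferentiable (by simp) x)
        (fun g => orbitProj_smul g x), map_zero]
  -- The range has dimension dim M/G, while R^⊥ has dimension dim M − dim G by freeness; the fibre
  -- bound gives the missing inequality.
  · have h1 : finrank ℝ E ≤ finrank ℝ E₂ + finrank ℝ E₁ := by
      refine finrank_le_of_fibre_subset_range hsub
        (contMDiff_orbitMap (E := E) (E₁ := E₁) (G := G) x) fun y hy => ?_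
      exact Quotient.exact hy
    have h2 : finrank ℝ (LinearMap.range (generatorMap E (E₁ := E₁) G x)) = finrank ℝ E₁ :=
      LinearMap.finrank_range_of_inj (generatorMap_injective x)
    have h3 : finrank ℝ (LinearMap.range (Ω.reducedSharp E₂ G x)) = finrank ℝ E₂ :=
      (LinearMap.finrank_range_of_inj (SymplecticForm.reducedSharp_injective hπ x)).trans
        (finrank_cotangent (E := E₂))
    rw [LinearMap.BilinForm.finrank_orthogonal (Ω.nondegenerate_bilin x), h2, h3]
    change finrank ℝ E - _ ≤ _
    omega

end Reduction

/-! ### The momentum map and Noether's theorem -/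

section Integrals

variable {E E₁ : Type*}
  [NormedAddCommGroup E] [NormedSpace ℝ E] [FiniteDimensional ℝ E]
  [NormedAddCommGroup E₁] [NormedSpace ℝ E₁]
  {M : Type*} [TopologicalSpace M] [ChartedSpace E M] [IsManifold 𝓘(ℝ, E) ∞ M]
  {Ω : SymplecticForm E M}
  {G : Type*} [TopologicalSpace G] [ChartedSpace E₁ G] [Group G] [MulAction G M]
  {Φ : M → Module.Dual ℝ (GroupLieAlgebra 𝓘(ℝ, E₁) G)}

/-- The comomentum map `ξ ↦ φ_ξ`. -/
noncomputable def comomentum (Φ : M → Module.Dual ℝ (GroupLieAlgebra 𝓘(ℝ, E₁) G)) :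
    GroupLieAlgebra 𝓘(ℝ, E₁) G →ₗ[ℝ] (M → ℝ) where
  toFun ξ x := Φ x ξ
  map_add' ξ η := funext fun x => map_add (Φ x) ξ η
  map_smul' c ξ := funext fun x => map_smul (Φ x) c ξ

theorem IsMomentumMap.contMDiff_comomentum (hΦ : IsMomentumMap Ω Φ)
    (ξ : GroupLieAlgebra 𝓘(ℝ, E₁) G) :
    ContMDiff 𝓘(ℝ, E) 𝓘(ℝ, ℝ) ∞ (comomentum Φ ξ) := hΦ.smooth ξ

theorem IsMomentumMap.sharp_comomentum (hΦ : IsMomentumMap Ω Φ)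
    (ξ : GroupLieAlgebra 𝓘(ℝ, E₁) G) (x : M) :
    Ω.sharp x (differential E (comomentum Φ ξ) x) = generatorMap E G x ξ := by
  rw [Ω.sharp_differential, generatorMap_apply, hΦ.generator_eq]
  rfl

/-- Noether's theorem: invariant functions commute with the momentum map. -/
theorem IsMomentumMap.bracket_comomentum_eq_zero [ContMDiffSMul 𝓘(ℝ, E₁) 𝓘(ℝ, E) ∞ G M]
    (hΦ : IsMomentumMap Ω Φ) {f : M → ℝ} (hf : MDifferentiable 𝓘(ℝ, E) 𝓘(ℝ, ℝ) f)
    (hinv : ∀ (g : G) (x : M), f (g • x) = f x) (ξ : GroupLieAlgebra 𝓘(ℝ, E₁) G) :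
    Ω.bracket f (comomentum Φ ξ) = 0 := by
  funext x
  rw [Ω.bracket_eq, ← Ω.sharp_differential, hΦ.sharp_comomentum]
  exact mfderiv_generator_eq_zero (hf x) (fun g => hinv g x) ξ

end Integrals

/-! ### The lifted algebra of integrals -/

section Lift

variable {E₁ : Type*} [NormedAddCommGroup E₁] [NormedSpace ℝ E₁] {M G : Type*}
  [TopologicalSpace G] [ChartedSpace E₁ G] [Group G] [MulAction G M]
  {Φ : M → Module.Dual ℝ (GroupLieAlgebra 𝓘(ℝ, E₁) G)}

/-- The sum of the pull-back of a space `F` of functions on `M/G` and of the space of components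
of the momentum map. -/
noncomputable def liftedIntegrals (Φ : M → Module.Dual ℝ (GroupLieAlgebra 𝓘(ℝ, E₁) G))
    (F : Submodule ℝ (OrbitSpace G M → ℝ)) : Submodule ℝ (M → ℝ) :=
  F.map (LinearMap.funLeft ℝ ℝ (orbitProj G)) ⊔ LinearMap.range (comomentum Φ)

theorem mem_liftedIntegrals {F : Submodule ℝ (OrbitSpace G M → ℝ)} {f : M → ℝ} :
    f ∈ liftedIntegrals Φ F ↔ ∃ a ∈ F, ∃ ξ, a ∘ orbitProj G + comomentum Φ ξ = f := by
  constructor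
  · intro hf
    obtain ⟨_, ⟨a, ha, rfl⟩, _, ⟨ξ, rfl⟩, rfl⟩ := Submodule.mem_sup.1 hf
    exact ⟨a, ha, ξ, rfl⟩
  · rintro ⟨a, ha, ξ, rfl⟩
    exact Submodule.add_mem_sup ⟨a, ha, rfl⟩ ⟨ξ, rfl⟩

variable {E E₂ : Type*} [NormedAddCommGroup E] [NormedSpace ℝ E] [FiniteDimensional ℝ E]
  [NormedAddCommGroup E₂] [NormedSpace ℝ E₂]
  [TopologicalSpace M] [ChartedSpace E M] [IsManifold 𝓘(ℝ, E) ∞ M]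
  {Ω : SymplecticForm E M} [ChartedSpace E₂ (OrbitSpace G M)]

/-- The two summands commute by Noether's theorem. Within them, pull-backs close up through the
reduced bracket and momenta through the Lie bracket. -/
theorem isAlgebraOfIntegrals_liftedIntegrals
    [ContMDiffSMul 𝓘(ℝ, E₁) 𝓘(ℝ, E) ∞ G M] (hΩ : Ω.IsInvariant G) (hΦ : IsMomentumMap Ω Φ)
    (hπ : Manifold.IsSubmersion 𝓘(ℝ, E) 𝓘(ℝ, E₂) ∞ (orbitProj G : M → OrbitSpace G M))
    {h : M → ℝ} (hsmooth : ContMDiff 𝓘(ℝ, E) 𝓘(ℝ, ℝ) ∞ h)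
    (hinv : ∀ (g : G) (x : M), h (g • x) = h x)
    {F : Submodule ℝ (OrbitSpace G M → ℝ)}
    (hF : IsAlgebraOfIntegrals E₂ (Ω.reducedBracket G) (reducedFunction h hinv) F) :
    IsAlgebraOfIntegrals E Ω.bracket h (liftedIntegrals Φ F) := by
  have hsm : ∀ a ∈ F, ContMDiff 𝓘(ℝ, E) 𝓘(ℝ, ℝ) ∞ (a ∘ orbitProj G : M → ℝ) :=
    fun a ha => (hF.smooth a ha).comp hπ.contMDiff
  have hda : ∀ a ∈ F, MDifferentiable 𝓘(ℝ, E) 𝓘(ℝ, ℝ) (a ∘ orbitProj G : M → ℝ) :=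
    fun a ha => (hsm a ha).mdifferentiable (by simp)
  have hdξ : ∀ ξ, MDifferentiable 𝓘(ℝ, E) 𝓘(ℝ, ℝ) (comomentum Φ ξ) :=
    fun ξ => (hΦ.contMDiff_comomentum ξ).mdifferentiable (by simp)
  have hzero : ∀ a ∈ F, ∀ ξ, Ω.bracket (a ∘ orbitProj G) (comomentum Φ ξ) = 0 :=
    fun a ha ξ => hΦ.bracket_comomentum_eq_zero (hda a ha)
      (fun g x => congrArg a (orbitProj_smul g x)) ξ
  refine ⟨?_, ?_, ?_⟩
  · intro f hf
    obtain ⟨a, ha, ξ, rfl⟩ := mem_liftedIntegrals.1 hf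
    exact (hsm a ha).add (hΦ.contMDiff_comomentum ξ)
  · intro f hf f' hf'
    obtain ⟨a, ha, ξ, rfl⟩ := mem_liftedIntegrals.1 hf
    obtain ⟨b, hb, η, rfl⟩ := mem_liftedIntegrals.1 hf'
    refine mem_liftedIntegrals.2 ⟨_, hF.bracket_mem a ha b hb, ⁅ξ, η⁆, ?_⟩
    rw [Ω.bracket_add_left _ (hda a ha) (hdξ ξ), Ω.bracket_add_right _ (hda b hb) (hdξ η),
      Ω.bracket_add_right _ (hda b hb) (hdξ η), hzero a ha η,
      Ω.bracket_antisymm (comomentum Φ ξ) (b ∘ _), hzero b hb ξ, neg_zero, add_zero, zero_add]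
    congr 1
    · funext x
      exact reducedBracket_orbitProj Ω hΩ (contMDiff_smul_left E₁) a b (hsm a ha) (hsm b hb) x
    · exact hΦ.bracket_eq ξ η
  · intro f hf x
    obtain ⟨a, ha, ξ, rfl⟩ := mem_liftedIntegrals.1 hf
    have h1 : Ω.bracket (a ∘ orbitProj G) h x = 0 := by
      have := reducedBracket_orbitProj Ω hΩ (contMDiff_smul_left E₁) a (reducedFunction h hinv)
        (hsm a ha) hsmooth x
      exact this.symm.trans (hF.integral a ha _)
    rw [Ω.bracket_add_left h (hda a ha) (hdξ ξ), Pi.add_apply, h1,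
      Ω.bracket_antisymm (comomentum Φ ξ) h,
      hΦ.bracket_comomentum_eq_zero (hsmooth.mdifferentiable (by simp)) hinv ξ]
    simp

/-- Identifies the Hamiltonian vectors of the lifted algebra as A + R: the momenta contribute
exactly the orbit directions. -/
theorem map_diffSpan_liftedIntegrals (hΦ : IsMomentumMap Ω Φ)
    (hπ : Manifold.IsSubmersion 𝓘(ℝ, E) 𝓘(ℝ, E₂) ∞ (orbitProj G : M → OrbitSpace G M))
    {F : Submodule ℝ (OrbitSpace G M → ℝ)} (hF : ∀ f ∈ F, ContMDiff 𝓘(ℝ, E₂) 𝓘(ℝ, ℝ) ∞ f)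
    (x : M) :
    (diffSpan E (liftedIntegrals Φ F : Set (M → ℝ)) x).map (Ω.sharp x) =
      (diffSpan E₂ (F : Set (OrbitSpace G M → ℝ)) (orbitProj G x)).map (Ω.reducedSharp E₂ G x) ⊔
        LinearMap.range (generatorMap E (E₁ := E₁) G x) := by
  unfold liftedIntegrals
  rw [diffSpan_sup, Submodule.map_sup]
  · unfold diffSpan
    congr 1
    · rw [Submodule.map_span, Submodule.map_span, Submodule.map_coe, Set.image_image,
        Set.image_image, Set.image_image]
      congr 1
      exact Set.image_congr fun f hf =>
        (SymplecticForm.reducedSharp_differential hπ (hF f hf) x).symm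
    · rw [Submodule.map_span, LinearMap.coe_range, ← Set.range_comp, ← Set.range_comp]
      have : (Ω.sharp x ∘ (fun f => differential E f x) ∘ comomentum Φ) =
          generatorMap E (E₁ := E₁) G x := funext fun ξ => hΦ.sharp_comomentum ξ x
      rw [this, ← LinearMap.coe_range, Submodule.span_eq]
  · rintro _ ⟨f, hf, rfl⟩
    exact ((hF f hf).comp hπ.contMDiff).mdifferentiable (by simp) x
  · rintro _ ⟨ξ, rfl⟩
    exact (hΦ.contMDiff_comomentum ξ).mdifferentiable (by simp) x

end Lift
end PoissonReduction

/-! ### The main theorem -/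

theorem theorem5p1
    {E E₁ E₂ : Type*}
    [NormedAddCommGroup E] [NormedSpace ℝ E] [FiniteDimensional ℝ E]
    [NormedAddCommGroup E₁] [NormedSpace ℝ E₁] [FiniteDimensional ℝ E₁]
    [NormedAddCommGroup E₂] [NormedSpace ℝ E₂] [FiniteDimensional ℝ E₂]
    -- the connected symplectic manifold
    {M : Type*} [TopologicalSpace M] [T2Space M] [SecondCountableTopology M] [ConnectedSpace M]
    [ChartedSpace E M] [IsManifold 𝓘(ℝ, E) ∞ M] (Ω : SymplecticForm E M)
    -- the connected Lie group, acting smoothly, freely and properly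
    {G : Type*} [TopologicalSpace G] [T2Space G] [SecondCountableTopology G] [ConnectedSpace G]
    [ChartedSpace E₁ G] [Group G] [LieGroup 𝓘(ℝ, E₁) ∞ G]
    [MulAction G M] [ContMDiffSMul 𝓘(ℝ, E₁) 𝓘(ℝ, E) ∞ G M] [IsCancelSMul G M] [ProperSMul G M]
    -- the action is Hamiltonian
    (hΩ : Ω.IsInvariant G)
    (Φ : M → Module.Dual ℝ (GroupLieAlgebra 𝓘(ℝ, E₁) G)) (hΦ : IsMomentumMap Ω Φ)
    -- the quotient manifold: the smooth structure on the orbit space making `π` a submersion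
    [ChartedSpace E₂ (OrbitSpace G M)] [IsManifold 𝓘(ℝ, E₂) ∞ (OrbitSpace G M)]
    (hπ : Manifold.IsSubmersion 𝓘(ℝ, E) 𝓘(ℝ, E₂) ∞ (orbitProj G : M → OrbitSpace G M))
    -- the invariant Hamiltonian
    (h : M → ℝ) (hsmooth : ContMDiff 𝓘(ℝ, E) 𝓘(ℝ, ℝ) ∞ h)
    (hinv : ∀ (g : G) (x : M), h (g • x) = h x)
    -- the reduced flow is completely integrable
    (hred : PoissonCompletelyIntegrable E₂ (Ω.reducedBracket G) (reducedFunction h hinv)) :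
    Ω.CompletelyIntegrable h := by
  obtain ⟨F, hF, l, r, c, ⟨U, hUo, hUd, hU⟩, ⟨V, hVo, hVd, hV⟩, hlrc⟩ := hred
  have : ContinuousSMul G M := ContMDiffSMul.continuousSMul (I := 𝓘(ℝ, E₁)) (I' := 𝓘(ℝ, E)) ∞
  have hopen : IsOpenMap (orbitProj G : M → OrbitSpace G M) := isOpenMap_quotient_mk'_mul
  have hcont : Continuous (orbitProj G : M → OrbitSpace G M) := continuous_quotient_mk'
  -- Genericity lifts from M/G to M because π is open.
  have hUVd : Dense (orbitProj G ⁻¹' (U ∩ V) : Set M) :=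
    (hUd.inter_of_isOpen_left hVd hUo).preimage hopen
  have key : ∀ x : M, orbitProj G x ∈ U ∩ V →
      Module.finrank ℝ (diffSpan E (liftedIntegrals Φ F : Set (M → ℝ)) x) + r =
          Module.finrank ℝ E ∧
        Module.finrank ℝ (diffKernel E Ω.bracket (liftedIntegrals Φ F : Set (M → ℝ)) x) = r := by
    rintro x ⟨hxU, hxV⟩
    have : FiniteDimensional ℝ (TangentSpace 𝓘(ℝ, E) x) :=
      inferInstanceAs (FiniteDimensional ℝ E)
    have hinj := SymplecticForm.reducedSharp_injective (Ω := Ω) hπ x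
    have hsmooth' := (isAlgebraOfIntegrals_liftedIntegrals hΩ hΦ hπ hsmooth hinv hF).smooth
    have hmapF := map_diffKernel (Ω.reducedBracket G) F (orbitProj G x)
      (fun f hf => (hF.smooth f hf).mdifferentiable (by simp) _) (Ω.bilin x)
      (Ω.reducedSharp E₂ G x)
      (fun f hf g hg => reducedBracket_eq_bilin (E₁ := E₁) hΩ hπ (hF.smooth f hf) (hF.smooth g hg) x)
    have hmapC := map_diffKernel (Ω.reducedBracket G) (smoothSubmodule E₂ (OrbitSpace G M))
      (orbitProj G x)
      (fun f (hf : ContMDiff _ _ _ f) => hf.mdifferentiable (by simp) _) (Ω.bilin x)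
      (Ω.reducedSharp E₂ G x)
      (fun f hf g hg => reducedBracket_eq_bilin (E₁ := E₁) hΩ hπ hf hg x)
    have hmapM := map_diffKernel Ω.bracket (liftedIntegrals Φ F) x
      (fun f hf => (hsmooth' f hf).mdifferentiable (by simp) _) (Ω.bilin x) (Ω.sharp x)
      (fun f _ g _ => Ω.bracket_eq_bilin f g x)
    -- Properness makes M/G Hausdorff, so bump functions realise every covector. The corank thereby
    -- becomes the dimension of the radical of R^⊥.
    have hspan : diffSpan E₂ (smoothSubmodule E₂ (OrbitSpace G M) : Set _) (orbitProj G x) = ⊤ :=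
      diffSpan_smoothFunctions _
    have hrange := SymplecticForm.range_reducedSharp (Ω := Ω) (E₁ := E₁) hπ x
    rw [hspan, Submodule.map_top, hrange] at hmapC
    rw [map_diffSpan_liftedIntegrals hΦ hπ hF.smooth x] at hmapM
    have hc : Module.finrank ℝ (diffKernel E₂ (Ω.reducedBracket G)
      (smoothSubmodule E₂ (OrbitSpace G M) : Set _) (orbitProj G x)) = c := hV _ hxV
    have hE₂ : Module.finrank ℝ (LinearMap.range (Ω.reducedSharp E₂ G x)) =
        Module.finrank ℝ E₂ :=
      (LinearMap.finrank_range_of_inj hinj).trans (finrank_cotangent (E := E₂))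
    have hl := (hU _ hxU).1
    have hr := (hU _ hxU).2
    -- All dimensions on the quotient are transported into T_xM along the injective map, turning
    -- reduced completeness into the hypothesis of `finrank_sup_of_complete`.
    rw [← finrank_map_of_injective hinj] at hl hr hc
    rw [hmapF] at hr
    rw [hmapC] at hc
    rw [hrange] at hE₂
    have hle : (diffSpan E₂ (F : Set (OrbitSpace G M → ℝ)) (orbitProj G x)).map
        (Ω.reducedSharp E₂ G x) ≤ (Ω.bilin x).orthogonal
          (LinearMap.range (generatorMap E (E₁ := E₁) G x)) := by
      rw [← hrange]
      exact LinearMap.map_le_range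
    have hfin := finrank_sup_of_complete (Ω.nondegenerate_bilin x) (Ω.isRefl_bilin x) hle
      (by rw [hl, hr, hc, hE₂, hlrc])
    rw [← hmapM, ← map_diffSpan_liftedIntegrals hΦ hπ hF.smooth x,
      finrank_map_of_injective (Ω.sharp_injective x),
      finrank_map_of_injective (Ω.sharp_injective x), hr] at hfin
    exact hfin
  -- One generic point suffices to show r ≤ dim M, so that the truncated subtraction in the witness
  -- dim M − r for ddim is exact.
  obtain ⟨x₀, hx₀⟩ := hUVd.nonempty
  have hx₀' := (key x₀ hx₀).1
  refine ⟨liftedIntegrals Φ F, isAlgebraOfIntegrals_liftedIntegrals hΩ hΦ hπ hsmooth hinv hF,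
    Module.finrank ℝ E - r, r,
    ⟨_, (hUo.inter hVo).preimage hcont, hUVd, fun x hx => ⟨?_, (key x hx).2⟩⟩, by omega⟩
  have := (key x hx).1
  omega
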